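/- Let $c,\beta,d>0$. Consider the planar system $$\dot u=c\Big(\frac{\beta u^2}{v}-u\Big),\qquad \dot v=b+u^2-dv \qquad (2.1)$$ with parameter $b$, write $F(u,v,b)$ for its right-hand side, and put $b_{SN}=\frac{d^2\beta^2}{4}$ and $E_1=\big(\frac{d\beta}{2},\frac{d\beta^2}{2}\big)$. (1) The system has no positive equilibrium ($u,v>0$) for $b>b_{SN}$, exactly one, namely $E_1$, for $b=b_{SN}$, and exactly two for $0<b<b_{SN}$. (2) At $(E_1,b_{SN})$ the Jacobian $A=DF$ has a one-dimensional kernel, spanned by $V=(1,\beta)^T$; $W=(1,-\frac{c}{d\beta})^T$ satisfies $W^TA=0$; and the transversality conditions $W^TF_b(E_1,b_{SN})\neq 0$ and $W^T\big[D^2F(E_1,b_{SN})(V,V)\big]\neq 0$ hold. (3) The equilibria have a fold at $(E_1,b_{SN})$: near this point they form a smooth curve in $\mathbb R^2\times\mathbb R$ with nonzero velocity in $\mathbb R^2$, tangent at $(E_1,b_{SN})$ to the plane $b=b_{SN}$ with quadratic contact; in every sufficiently small neighbourhood of $E_1$ and for $b$ close enough to $b_{SN}$ (depending on the neighbourhood)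 there are exactly two equilibria if $b<b_{SN}$, whose Jacobian determinants are nonzero and of opposite sign, only $E_1$ if $b=b_{SN}$, and none if $b>b_{SN}$. (4) If $d\neq c$, system (2.1) undergoes a saddle-node bifurcation at $E_1$ as $b$ passes through $b_{SN}$. That is, in addition to (3), $0$ is an (algebraically) simple eigenvalue of $A$ and the only one on the imaginary axis, and, with $k$ the number of eigenvalues of $A$ with negative real part, the two equilibria near $E_1$ for $b<b_{SN}$ close to $b_{SN}$ are hyperbolic and have stable manifolds of dimensions $k$ and $k+1$, respectively (the dimension of the stable manifold of a hyperbolic equilibrium being the number of eigenvalues of its Jacobian with negative real part, counted with multiplicity). -/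

import Mathlib

open Filter Topology
open scoped ContDiff

noncomputable section

section General

variable {E : Type*} [NormedAddCommGroup E] [NormedSpace ℝ E] [FiniteDimensional ℝ E]

/-- The complex eigenvalues of a real linear map, with algebraic multiplicity. -/
def complexEigenvalues (A : E →L[ℝ] E) : Multiset ℂ :=
  ((A : E →ₗ[ℝ] E).charpoly.map (algebraMap ℝ ℂ)).roots

open Classical in
/-- The number of eigenvalues with negative real part, counted with algebraic multiplicity;
for a hyperbolic equilibrium with linearization `A`, the dimension of its stable manifold. -/
def stableDim (A : E →L[ℝ] E) : ℕ :=
  ((complexEigenvalues A).filter (fun z => z.re < 0)).card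

/-- `x` is an equilibrium of `ẋ = G x` at which the linearization has no eigenvalue on the
imaginary axis. -/
def IsHyperbolicEquilibrium (G : E → E) (x : E) : Prop :=
  G x = 0 ∧ DifferentiableAt ℝ G x ∧ ∀ z ∈ complexEigenvalues (fderiv ℝ G x), z.re ≠ 0

/-- The transversality conditions for the family `ẋ = F μ x` at the equilibrium `x₀` for `μ = μ₀`:
with `A` the Jacobian at `x₀`, the eigenvalue `0` of `A` has a one-dimensional eigenspace,
`V` is a right and `W` a left null vector of `A` (`W` is written as a linear functional, `p ↦ Wᵀ p`),
and `Wᵀ F_μ ≠ 0` and `Wᵀ D²F(V, V) ≠ 0`. -/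
structure TransversalityConditions (F : ℝ → E → E) (x₀ : E) (μ₀ : ℝ) (V : E) (W : E →L[ℝ] ℝ) :
    Prop where
  smooth : ContDiffAt ℝ ∞ (fun p : ℝ × E => F p.1 p.2) (μ₀, x₀)
  equilibrium : F μ₀ x₀ = 0
  finrank_ker : Module.finrank ℝ (LinearMap.ker (fderiv ℝ (F μ₀) x₀ : E →ₗ[ℝ] E)) = 1
  right_ne : V ≠ 0
  right_null : fderiv ℝ (F μ₀) x₀ V = 0
  left_ne : W ≠ 0
  left_null : W.comp (fderiv ℝ (F μ₀) x₀) = 0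
  param : W (deriv (fun μ => F μ x₀) μ₀) ≠ 0
  quadratic : W (iteratedFDeriv ℝ 2 (F μ₀) x₀ ![V, V]) ≠ 0

/-- The equilibria of the family `ẋ = F μ x` have a (quadratic) fold at `(x₀, μ₀)`. The sign
`σ = ±1` says on which side of `μ₀` the equilibria are: two of them near `x₀` for
`σ (μ - μ₀) > 0`, none for `σ (μ - μ₀) < 0`. -/
structure IsFold (F : ℝ → E → E) (x₀ : E) (μ₀ : ℝ) (σ : ℤˣ) : Prop where
  smooth : ContDiffAt ℝ ∞ (fun p : ℝ × E => F p.1 p.2) (μ₀, x₀)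
  /-- Near `(x₀, μ₀)` the equilibria form a smooth curve through `(x₀, μ₀)`, tangent there to
  `μ = μ₀`, with quadratic contact. -/
  curve : ∃ (δ : ℝ) (x : ℝ → E) (m : ℝ → ℝ), 0 < δ ∧
    ContDiffOn ℝ ∞ x (Set.Ioo (-δ) δ) ∧ ContDiffOn ℝ ∞ m (Set.Ioo (-δ) δ) ∧
    x 0 = x₀ ∧ m 0 = μ₀ ∧
    deriv x 0 ≠ 0 ∧ deriv m 0 = 0 ∧ 0 < ((σ : ℤ) : ℝ) * iteratedDeriv 2 m 0 ∧
    ∀ᶠ p : ℝ × E in 𝓝 (μ₀, x₀),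
      F p.1 p.2 = 0 ↔ ∃ s ∈ Set.Ioo (-δ) δ, p = (m s, x s)
  /-- In every small enough neighbourhood of `x₀`: exactly two equilibria on one side of `μ₀`, both
  nondegenerate and with Jacobian determinants of opposite sign, only `x₀` for `μ = μ₀`, and none
  on the other side. -/
  count : ∃ U ∈ 𝓝 x₀, ∀ N ∈ 𝓝 x₀, N ⊆ U → ∀ᶠ μ in 𝓝 μ₀,
    (0 < ((σ : ℤ) : ℝ) * (μ - μ₀) → ∃ y z, y ≠ z ∧ {w ∈ N | F μ w = 0} = {y, z} ∧
      (fderiv ℝ (F μ) y).det < 0 ∧ 0 < (fderiv ℝ (F μ) z).det) ∧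
    (μ = μ₀ → {w ∈ N | F μ w = 0} = {x₀}) ∧
    (((σ : ℤ) : ℝ) * (μ - μ₀) < 0 → {w ∈ N | F μ w = 0} = ∅)

/-- The family `ẋ = F μ x` undergoes a saddle-node bifurcation at `x₀` as `μ` passes through `μ₀`:
the equilibria have a fold at `(x₀, μ₀)`; the Jacobian at `(x₀, μ₀)` has the simple eigenvalue `0`,
no other eigenvalue on the imaginary axis, and `k` eigenvalues with negative real part; and the two
equilibria that emerge from `x₀` are hyperbolic with stable manifolds of dimensions `k` and
`k + 1`. -/
structure IsSaddleNodeBifurcation (F : ℝ → E → E) (x₀ : E) (μ₀ : ℝ) (σ : ℤˣ) : Prop where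
  fold : IsFold F x₀ μ₀ σ
  simple_zero : (fderiv ℝ (F μ₀) x₀ : E →ₗ[ℝ] E).charpoly.rootMultiplicity 0 = 1
  other_eigenvalues : ∀ z ∈ complexEigenvalues (fderiv ℝ (F μ₀) x₀), z ≠ 0 → z.re ≠ 0
  branches : ∃ U ∈ 𝓝 x₀, ∀ N ∈ 𝓝 x₀, N ⊆ U → ∀ᶠ μ in 𝓝 μ₀,
    0 < ((σ : ℤ) : ℝ) * (μ - μ₀) → ∃ y z, y ≠ z ∧ {w ∈ N | F μ w = 0} = {y, z} ∧
      IsHyperbolicEquilibrium (F μ) y ∧ IsHyperbolicEquilibrium (F μ) z ∧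
      stableDim (fderiv ℝ (F μ) y) = stableDim (fderiv ℝ (F μ₀) x₀) ∧
      stableDim (fderiv ℝ (F μ) z) = stableDim (fderiv ℝ (F μ₀) x₀) + 1

end General

/-- The vector field `(u, v) ↦ (c (β u² / v - u), b + u² - d v)` of the Gierer–Meinhardt model. -/
def gmField (c β d b : ℝ) (p : ℝ × ℝ) : ℝ × ℝ :=
  (c * (β * p.1 ^ 2 / p.2 - p.1), b + p.1 ^ 2 - d * p.2)

/-- The set of positive equilibria. -/
def gmPositiveEquilibria (c β d b : ℝ) : Set (ℝ × ℝ) :=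
  {p | 0 < p.1 ∧ 0 < p.2 ∧ gmField c β d b p = 0}

/-- The critical value `b_SN = d² β² / 4`. -/
def gmThreshold (β d : ℝ) : ℝ := d ^ 2 * β ^ 2 / 4

/-- The equilibrium `E₁ = (d β / 2, d β² / 2)`. -/
def gmE1 (β d : ℝ) : ℝ × ℝ := (d * β / 2, d * β ^ 2 / 2)

end

/-! For `u, v > 0` the first equation forces `v = βu`; the second then reads `b = b_SN - s²` with `s
= u - dβ/2`. So the equilibria form an explicit curve (`gmField_eq_zero_iff`), and counts and fold
need no implicit function theorem. On this curve the Jacobian has constant trace `c - d` and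
determinant `2cs/β`. Hence `s < 0` gives a saddle, and `s > 0` a sink if `c < d`, a source if `c >
d`. At `s = 0` the eigenvalues are `0` and `c - d`, so `k` is 1 or 0 respectively, which gives the
stable dimensions `k` and `k + 1`. -/

/-! ### Eigenvalues of planar linear maps from trace and determinant. -/

lemma toMatrix_finTwoProd (A : ℝ × ℝ →L[ℝ] ℝ × ℝ) :
    LinearMap.toMatrix (Module.Basis.finTwoProd ℝ) (Module.Basis.finTwoProd ℝ)
      (A : ℝ × ℝ →ₗ[ℝ] ℝ × ℝ) = !![(A (1, 0)).1, (A (0, 1)).1; (A (1, 0)).2, (A (0, 1)).2] := by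
  ext i j
  fin_cases i <;> fin_cases j <;> simp [LinearMap.toMatrix_apply]

open Polynomial in
lemma charpoly_continuousLinearMap_real_prod (A : ℝ × ℝ →L[ℝ] ℝ × ℝ) :
    (A : ℝ × ℝ →ₗ[ℝ] ℝ × ℝ).charpoly =
      X ^ 2 - C ((A (1, 0)).1 + (A (0, 1)).2) * X + C A.det := by
  rw [ContinuousLinearMap.det, ← LinearMap.det_toMatrix (Module.Basis.finTwoProd ℝ),
    ← LinearMap.charpoly_toMatrix _ (Module.Basis.finTwoProd ℝ), Matrix.charpoly_fin_two,
    toMatrix_finTwoProd, Matrix.trace_fin_two_of]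

lemma det_continuousLinearMap_real_prod (A : ℝ × ℝ →L[ℝ] ℝ × ℝ) :
    A.det = (A (1, 0)).1 * (A (0, 1)).2 - (A (0, 1)).1 * (A (1, 0)).2 := by
  rw [ContinuousLinearMap.det, ← LinearMap.det_toMatrix (Module.Basis.finTwoProd ℝ),
    toMatrix_finTwoProd, Matrix.det_fin_two_of]

open Polynomial in
lemma exists_complexEigenvalues_eq_pair (A : ℝ × ℝ →L[ℝ] ℝ × ℝ) :
    ∃ z w : ℂ, complexEigenvalues A = {z, w} ∧
      z + w = (((A (1, 0)).1 + (A (0, 1)).2 : ℝ) : ℂ) ∧ z * w = ((A.det : ℝ) : ℂ) := by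
  set T : ℝ := (A (1, 0)).1 + (A (0, 1)).2 with hT
  set D : ℝ := A.det with hD
  -- A complex square root of the discriminant: the quadratic formula then covers real and conjugate
  -- pairs at once.
  obtain ⟨r, hr⟩ := IsAlgClosed.exists_pow_nat_eq ((T : ℂ) ^ 2 - 4 * D) (n := 2) (by norm_num)
  have hsum : ((T : ℂ) + r) / 2 + (T - r) / 2 = T := by ring
  have hprod : ((T : ℂ) + r) / 2 * ((T - r) / 2) = D := by linear_combination -hr / 4
  refine ⟨(T + r) / 2, (T - r) / 2, ?_, hsum, hprod⟩
  have hfac : ((A : ℝ × ℝ →ₗ[ℝ] ℝ × ℝ).charpoly.map (algebraMap ℝ ℂ)) =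
      (X - C (((T : ℂ) + r) / 2)) * (X - C (((T : ℂ) - r) / 2)) := by
    rw [charpoly_continuousLinearMap_real_prod, ← hT, ← hD]
    simp only [Polynomial.map_add, Polynomial.map_sub, Polynomial.map_pow, Polynomial.map_mul,
      Polynomial.map_X, Polynomial.map_C, Complex.coe_algebraMap]
    have h1 : (C (T : ℂ) : ℂ[X]) = C (((T : ℂ) + r) / 2) + C (((T : ℂ) - r) / 2) := by
      rw [← C_add, hsum]
    have h2 : (C (D : ℂ) : ℂ[X]) = C (((T : ℂ) + r) / 2) * C (((T : ℂ) - r) / 2) := by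
      rw [← C_mul, hprod]
    rw [h1, h2]
    ring
  rw [complexEigenvalues, hfac, roots_mul (mul_ne_zero (X_sub_C_ne_zero _) (X_sub_C_ne_zero _)),
    roots_X_sub_C, roots_X_sub_C]
  rfl

lemma stableDim_eq_of_complexEigenvalues {A : ℝ × ℝ →L[ℝ] ℝ × ℝ} {z w : ℂ}
    (h : complexEigenvalues A = {z, w}) :
    stableDim A = (if z.re < 0 then 1 else 0) + (if w.re < 0 then 1 else 0) := by
  rw [stableDim, h, Multiset.insert_eq_cons, Multiset.filter_cons, Multiset.filter_singleton]
  split_ifs <;> simp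

/-- The real and imaginary parts of two complex numbers with real sum and product. -/
lemma re_im_of_add_mul_real {z w : ℂ} {T D : ℝ} (hs : z + w = T) (hp : z * w = D) :
    z.re + w.re = T ∧ w.im = -z.im ∧ z.re * w.re + z.im ^ 2 = D ∧ z.im * (w.re - z.re) = 0 := by
  have h1 := congrArg Complex.re hs
  have h2 := congrArg Complex.im hs
  have h3 := congrArg Complex.re hp
  have h4 := congrArg Complex.im hp
  simp only [Complex.add_re, Complex.add_im, Complex.mul_re, Complex.mul_im, Complex.ofReal_re,
    Complex.ofReal_im] at h1 h2 h3 h4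
  have h5 : w.im = -z.im := by linarith
  rw [h5] at h3 h4
  exact ⟨h1, h5, by linarith, by linarith⟩

/-- A planar linear map with negative determinant is a saddle. -/
lemma saddle_of_det_neg {A : ℝ × ℝ →L[ℝ] ℝ × ℝ} (hD : A.det < 0) :
    (∀ z ∈ complexEigenvalues A, z.re ≠ 0) ∧ stableDim A = 1 := by
  obtain ⟨z, w, h, hs, hp⟩ := exists_complexEigenvalues_eq_pair A
  obtain ⟨-, -, h3, -⟩ := re_im_of_add_mul_real hs hp
  have hneg : z.re * w.re < 0 := by nlinarith [sq_nonneg z.im]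
  rw [stableDim_eq_of_complexEigenvalues h, h]
  simp only [Multiset.insert_eq_cons, Multiset.mem_cons, Multiset.mem_singleton,
    forall_eq_or_imp, forall_eq]
  rcases mul_neg_iff.1 hneg with ⟨h1, h2⟩ | ⟨h1, h2⟩
  · exact ⟨⟨h1.ne', h2.ne⟩, by simp [h1.le, h2]⟩
  · exact ⟨⟨h1.ne, h2.ne'⟩, by simp [h1, h2.le]⟩

/-- Either both numbers are real and the product is `D`, or the real parts coincide and equal `T / 2
≠ 0`. -/
lemma re_mul_re_pos {z w : ℂ} {T D : ℝ} (hs : z + w = T) (hp : z * w = D) (hT : T ≠ 0)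
    (hD : 0 < D) : 0 < z.re * w.re := by
  obtain ⟨h1, -, h3, h4⟩ := re_im_of_add_mul_real hs hp
  rcases mul_eq_zero.1 h4 with h | h
  · rw [h] at h3
    linarith
  · have hw : w.re = z.re := by linarith
    rw [hw]
    exact mul_self_pos.2 fun h0 => hT (by rw [← h1, hw, h0, add_zero])

/-- A planar linear map with positive determinant and negative trace is a sink. -/
lemma sink_of_det_pos {A : ℝ × ℝ →L[ℝ] ℝ × ℝ} (hD : 0 < A.det)
    (hT : (A (1, 0)).1 + (A (0, 1)).2 < 0) :
    (∀ z ∈ complexEigenvalues A, z.re ≠ 0) ∧ stableDim A = 2 := by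
  obtain ⟨z, w, h, hs, hp⟩ := exists_complexEigenvalues_eq_pair A
  have hpos := re_mul_re_pos hs hp hT.ne hD
  obtain ⟨h1, -⟩ := re_im_of_add_mul_real hs hp
  rw [stableDim_eq_of_complexEigenvalues h, h]
  simp only [Multiset.insert_eq_cons, Multiset.mem_cons, Multiset.mem_singleton,
    forall_eq_or_imp, forall_eq]
  rcases pos_and_pos_or_neg_and_neg_of_mul_pos hpos with ⟨h2, h3⟩ | ⟨h2, h3⟩
  · linarith
  · exact ⟨⟨h2.ne, h3.ne⟩, by simp [h2, h3]⟩

/-- A planar linear map with positive determinant and positive trace is a source. -/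
lemma source_of_det_pos {A : ℝ × ℝ →L[ℝ] ℝ × ℝ} (hD : 0 < A.det)
    (hT : 0 < (A (1, 0)).1 + (A (0, 1)).2) :
    (∀ z ∈ complexEigenvalues A, z.re ≠ 0) ∧ stableDim A = 0 := by
  obtain ⟨z, w, h, hs, hp⟩ := exists_complexEigenvalues_eq_pair A
  have hpos := re_mul_re_pos hs hp hT.ne' hD
  obtain ⟨h1, -⟩ := re_im_of_add_mul_real hs hp
  rw [stableDim_eq_of_complexEigenvalues h, h]
  simp only [Multiset.insert_eq_cons, Multiset.mem_cons, Multiset.mem_singleton,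
    forall_eq_or_imp, forall_eq]
  rcases pos_and_pos_or_neg_and_neg_of_mul_pos hpos with ⟨h2, h3⟩ | ⟨h2, h3⟩
  · exact ⟨⟨h2.ne', h3.ne'⟩, by simp [h2.le, h3.le]⟩
  · linarith

/-- The eigenvalues of a singular planar linear map are `0` and its trace. -/
lemma complexEigenvalues_of_det_eq_zero {A : ℝ × ℝ →L[ℝ] ℝ × ℝ} (hD : A.det = 0) :
    complexEigenvalues A = {0, (((A (1, 0)).1 + (A (0, 1)).2 : ℝ) : ℂ)} := by
  obtain ⟨z, w, h, hs, hp⟩ := exists_complexEigenvalues_eq_pair A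
  rw [hD, Complex.ofReal_zero] at hp
  rcases mul_eq_zero.1 hp with h0 | h0
  · rw [h, ← hs, h0, zero_add]
  · rw [h, ← hs, h0, add_zero, Multiset.pair_comm]

open Polynomial in
lemma rootMultiplicity_zero_charpoly_of_det_eq_zero {A : ℝ × ℝ →L[ℝ] ℝ × ℝ} (hD : A.det = 0)
    (hT : (A (1, 0)).1 + (A (0, 1)).2 ≠ 0) :
    (A : ℝ × ℝ →ₗ[ℝ] ℝ × ℝ).charpoly.rootMultiplicity 0 = 1 := by
  have hfac : (A : ℝ × ℝ →ₗ[ℝ] ℝ × ℝ).charpoly =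
      (X - C 0) * (X - C ((A (1, 0)).1 + (A (0, 1)).2)) := by
    rw [charpoly_continuousLinearMap_real_prod, hD, C_0]
    ring
  rw [hfac, rootMultiplicity_mul (mul_ne_zero (X_sub_C_ne_zero _) (X_sub_C_ne_zero _)),
    rootMultiplicity_X_sub_C_self, rootMultiplicity_X_sub_C, if_neg hT.symm]

/-! ### Derivative and smoothness of the field. -/

/-- The Jacobian of the Gierer–Meinhardt field. -/
noncomputable def gmJacobian (c β d : ℝ) (p : ℝ × ℝ) : ℝ × ℝ →L[ℝ] ℝ × ℝ :=
  ((c * (2 * β * p.1 / p.2 - 1)) • ContinuousLinearMap.fst ℝ ℝ ℝ -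
      (c * β * p.1 ^ 2 / p.2 ^ 2) • ContinuousLinearMap.snd ℝ ℝ ℝ).prod
    ((2 * p.1) • ContinuousLinearMap.fst ℝ ℝ ℝ - d • ContinuousLinearMap.snd ℝ ℝ ℝ)

lemma gmJacobian_apply (c β d : ℝ) (p q : ℝ × ℝ) :
    gmJacobian c β d p q = (c * (2 * β * p.1 / p.2 - 1) * q.1 - c * β * p.1 ^ 2 / p.2 ^ 2 * q.2,
      2 * p.1 * q.1 - d * q.2) := by
  simp [gmJacobian]

lemma hasFDerivAt_gmField (c β d b : ℝ) {p : ℝ × ℝ} (hp : p.2 ≠ 0) :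
    HasFDerivAt (gmField c β d b) (gmJacobian c β d p) p := by
  have h1 : HasFDerivAt (fun q : ℝ × ℝ => q.1) (ContinuousLinearMap.fst ℝ ℝ ℝ) p := hasFDerivAt_fst
  have h2 : HasFDerivAt (fun q : ℝ × ℝ => q.2) (ContinuousLinearMap.snd ℝ ℝ ℝ) p := hasFDerivAt_snd
  have hinv : HasFDerivAt (fun q : ℝ × ℝ => (q.2)⁻¹)
      (-(p.2 ^ 2)⁻¹ • ContinuousLinearMap.snd ℝ ℝ ℝ) p := (hasDerivAt_inv hp).comp_hasFDerivAt p h2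
  have hf := ((((h1.pow 2).const_mul β).mul hinv).sub h1).const_mul c
  have hg := ((h1.pow 2).const_add b).sub (h2.const_mul d)
  refine ((hf.prodMk hg).congr_fderiv ?_)
  ext <;> simp [gmJacobian] <;> field_simp <;> simp

lemma contDiffAt_gmField (c β d b : ℝ) {p : ℝ × ℝ} (hp : p.2 ≠ 0) :
    ContDiffAt ℝ ∞ (fun q : ℝ × (ℝ × ℝ) => gmField c β d q.1 q.2) (b, p) := by
  unfold gmField
  have : (b, p).2.2 ≠ 0 := hp
  fun_prop (disch := assumption)

/-! ### The explicit curve of equilibria. -/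

/-- The curve of equilibria of the Gierer–Meinhardt system, parametrized by the distance of `u`
from the fold. -/
noncomputable def gmCurve (β d s : ℝ) : ℝ × ℝ := (d * β / 2 + s, β * (d * β / 2 + s))

lemma gmCurve_zero (β d : ℝ) : gmCurve β d 0 = gmE1 β d := by
  simp only [gmCurve, gmE1, add_zero, Prod.mk.injEq, true_and]
  ring

lemma gmCurve_injective (β d : ℝ) : Function.Injective (gmCurve β d) := fun s t h => by
  simpa [gmCurve] using congrArg Prod.fst h

lemma contDiff_gmCurve (β d : ℝ) : ContDiff ℝ ∞ (gmCurve β d) := by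
  unfold gmCurve
  fun_prop

lemma hasDerivAt_gmCurve (β d s : ℝ) : HasDerivAt (gmCurve β d) (1, β) s := by
  have h := (hasDerivAt_id s).const_add (d * β / 2)
  exact (h.prodMk (h.const_mul β)).congr_deriv (by rw [mul_one])

/-- Positivity allows cancelling `c` and `u` and clearing `v`; the condition on `b` is a completed
square. -/
lemma gmField_eq_zero_iff {c β d b : ℝ} (hc : 0 < c) {p : ℝ × ℝ} (h1 : 0 < p.1)
    (h2 : 0 < p.2) : gmField c β d b p = 0 ↔
      p = gmCurve β d (p.1 - d * β / 2) ∧ b = gmThreshold β d - (p.1 - d * β / 2) ^ 2 := by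
  obtain ⟨u, v⟩ := p
  simp only at h1 h2
  simp only [gmField, gmCurve, gmThreshold, Prod.mk_eq_zero, Prod.mk.injEq, mul_eq_zero, hc.ne',
    false_or, add_sub_cancel, true_and]
  have key : β * u ^ 2 / v - u = 0 ↔ v = β * u := by
    rw [sub_eq_zero, div_eq_iff h2.ne']
    constructor
    · intro h
      exact mul_left_cancel₀ h1.ne' (by linarith)
    · rintro rfl
      ring
  rw [key]
  refine and_congr_right fun h => ?_
  subst h
  constructor <;> intro h <;> linarith

lemma gmPositiveEquilibria_eq_of_lt {c β d b : ℝ} (hc : 0 < c)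
    (h : gmThreshold β d < b) : gmPositiveEquilibria c β d b = ∅ := by
  refine Set.eq_empty_iff_forall_notMem.2 fun p ⟨h1, h2, h3⟩ => ?_
  have := ((gmField_eq_zero_iff hc h1 h2).1 h3).2
  nlinarith [sq_nonneg (p.1 - d * β / 2)]

lemma gmPositive_gmCurve {β d s : ℝ} (hβ : 0 < β) (hs : |s| < d * β / 2) :
    0 < (gmCurve β d s).1 ∧ 0 < (gmCurve β d s).2 := by
  have h : 0 < d * β / 2 + s := by linarith [(abs_lt.1 hs).1]
  exact ⟨h, mul_pos hβ h⟩

lemma gmField_gmCurve {c β d s : ℝ} (hc : 0 < c) (hβ : 0 < β) (hs : |s| < d * β / 2) :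
    gmField c β d (gmThreshold β d - s ^ 2) (gmCurve β d s) = 0 := by
  obtain ⟨h1, h2⟩ := gmPositive_gmCurve hβ hs
  rw [gmField_eq_zero_iff hc h1 h2]
  simp [gmCurve]

/-- The equilibria in the open positive quadrant are the points of `gmCurve` with `s² = b_SN - b`. -/
lemma gmField_eq_zero_iff_exists {c β d b : ℝ} (hc : 0 < c) {p : ℝ × ℝ} (h1 : 0 < p.1)
    (h2 : 0 < p.2) : gmField c β d b p = 0 ↔
      ∃ s, s ^ 2 = gmThreshold β d - b ∧ p = gmCurve β d s := by
  rw [gmField_eq_zero_iff hc h1 h2]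
  constructor
  · rintro ⟨h, h'⟩
    exact ⟨_, by linarith, h⟩
  · rintro ⟨s, hs, rfl⟩
    simp only [gmCurve, add_sub_cancel_left, true_and]
    linarith

/-- The equilibria in a set of the open positive quadrant. -/
lemma equilibria_eq_pair {c β d b : ℝ} (hc : 0 < c) {N : Set (ℝ × ℝ)}
    (hN : N ⊆ {p | 0 < p.1 ∧ 0 < p.2}) (hb : b ≤ gmThreshold β d)
    (hm : gmCurve β d (-√(gmThreshold β d - b)) ∈ N) (hp : gmCurve β d (√(gmThreshold β d - b)) ∈ N) :
    {w ∈ N | gmField c β d b w = 0} =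
      {gmCurve β d (-√(gmThreshold β d - b)), gmCurve β d (√(gmThreshold β d - b))} := by
  have hsq : √(gmThreshold β d - b) ^ 2 = gmThreshold β d - b := Real.sq_sqrt (by linarith)
  ext w
  simp only [Set.mem_ofPred_eq, Set.mem_insert_iff, Set.mem_singleton_iff]
  constructor
  · rintro ⟨hw, h⟩
    obtain ⟨s, hs, rfl⟩ := (gmField_eq_zero_iff_exists hc (hN hw).1 (hN hw).2).1 h
    rw [← hsq] at hs
    rcases sq_eq_sq_iff_eq_or_eq_neg.1 hs with h | h <;> simp [h]
  · rintro (rfl | rfl)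
    · exact ⟨hm, (gmField_eq_zero_iff_exists hc (hN hm).1 (hN hm).2).2 ⟨_, by rw [neg_sq, hsq], rfl⟩⟩
    · exact ⟨hp, (gmField_eq_zero_iff_exists hc (hN hp).1 (hN hp).2).2 ⟨_, hsq, rfl⟩⟩

lemma gmPositiveEquilibria_eq_pair {c β d b : ℝ} (hc : 0 < c) (hβ : 0 < β) (hd : 0 < d)
    (h0 : 0 < b) (hb : b ≤ gmThreshold β d) :
    gmPositiveEquilibria c β d b =
      {gmCurve β d (-√(gmThreshold β d - b)), gmCurve β d (√(gmThreshold β d - b))} := by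
  -- Since `b_SN = (dβ/2)²`, this is `b > 0`; it keeps the lower equilibrium in the positive
  -- quadrant.
  have hs : √(gmThreshold β d - b) < d * β / 2 := by
    rw [Real.sqrt_lt' (by positivity), gmThreshold]
    nlinarith
  have habs : |√(gmThreshold β d - b)| < d * β / 2 := by rwa [abs_of_nonneg (Real.sqrt_nonneg _)]
  rw [← equilibria_eq_pair hc subset_rfl hb (gmPositive_gmCurve hβ (by rwa [abs_neg]))
    (gmPositive_gmCurve hβ habs)]
  ext p
  simp [gmPositiveEquilibria, and_assoc]

lemma gmThreshold_pos {β d : ℝ} (hβ : 0 < β) (hd : 0 < d) : 0 < gmThreshold β d := by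
  unfold gmThreshold
  positivity

lemma gmCurve_neg_sqrt_ne {β d b : ℝ} (hb : b < gmThreshold β d) :
    gmCurve β d (-√(gmThreshold β d - b)) ≠ gmCurve β d (√(gmThreshold β d - b)) := fun h => by
  have h1 := gmCurve_injective β d h
  have h2 : 0 < √(gmThreshold β d - b) := Real.sqrt_pos.2 (by linarith)
  linarith

/-! ### Linearization along the curve. -/

/-- The ratio `u / v = 1 / β` is constant on the curve, so only the lower left entry depends on `s`.
-/
lemma fderiv_gmField_gmCurve {c β d b s : ℝ} (hβ : 0 < β)
    (hs : 0 < (gmCurve β d s).1 ∧ 0 < (gmCurve β d s).2) (q : ℝ × ℝ) :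
    fderiv ℝ (gmField c β d b) (gmCurve β d s) q =
      (c * q.1 - c / β * q.2, 2 * (d * β / 2 + s) * q.1 - d * q.2) := by
  rw [(hasFDerivAt_gmField c β d b hs.2.ne').fderiv, gmJacobian_apply]
  have h : 0 < d * β / 2 + s := hs.1
  simp only [gmCurve, Prod.mk.injEq, and_true]
  generalize d * β / 2 + s = u at h
  field_simp
  ring

lemma det_fderiv_gmField_gmCurve {c β d b s : ℝ} (hβ : 0 < β)
    (hs : 0 < (gmCurve β d s).1 ∧ 0 < (gmCurve β d s).2) :
    (fderiv ℝ (gmField c β d b) (gmCurve β d s)).det = 2 * c / β * s := by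
  rw [det_continuousLinearMap_real_prod, fderiv_gmField_gmCurve hβ hs, fderiv_gmField_gmCurve hβ hs]
  field_simp
  ring

lemma trace_fderiv_gmField_gmCurve {c β d b s : ℝ} (hβ : 0 < β)
    (hs : 0 < (gmCurve β d s).1 ∧ 0 < (gmCurve β d s).2) :
    (fderiv ℝ (gmField c β d b) (gmCurve β d s) (1, 0)).1 +
      (fderiv ℝ (gmField c β d b) (gmCurve β d s) (0, 1)).2 = c - d := by
  rw [fderiv_gmField_gmCurve hβ hs, fderiv_gmField_gmCurve hβ hs]
  ring

lemma gmPositive_gmE1 {β d : ℝ} (hβ : 0 < β) (hd : 0 < d) :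
    0 < (gmE1 β d).1 ∧ 0 < (gmE1 β d).2 := by
  constructor <;> simp only [gmE1] <;> positivity

lemma positiveQuadrant_mem_nhds {p : ℝ × ℝ} (hp : 0 < p.1 ∧ 0 < p.2) :
    {q : ℝ × ℝ | 0 < q.1 ∧ 0 < q.2} ∈ 𝓝 p :=
  ((isOpen_lt continuous_const continuous_fst).inter
    (isOpen_lt continuous_const continuous_snd)).mem_nhds hp

/-- The two-sided neighbourhood of `b_SN` is harmless: `√` vanishes on negative numbers, so both
points are `E₁` for `b > b_SN`. -/
lemma eventually_gmCurve_mem (β d : ℝ) {N : Set (ℝ × ℝ)} (hN : N ∈ 𝓝 (gmE1 β d)) :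
    ∀ᶠ b in 𝓝 (gmThreshold β d), gmCurve β d (-√(gmThreshold β d - b)) ∈ N ∧
      gmCurve β d (√(gmThreshold β d - b)) ∈ N := by
  have hcont := (contDiff_gmCurve β d).continuous
  have h0 : √(gmThreshold β d - gmThreshold β d) = 0 := by simp
  have hm : Continuous fun b => gmCurve β d (-√(gmThreshold β d - b)) := by fun_prop
  have hp : Continuous fun b => gmCurve β d (√(gmThreshold β d - b)) := by fun_prop
  refine (hm.continuousAt.eventually_mem ?_).and (hp.continuousAt.eventually_mem ?_)
  · rwa [h0, neg_zero, gmCurve_zero]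
  · rwa [h0, gmCurve_zero]

/-- `V = (1, β)` is the velocity of `gmCurve`, so `D²F(V, V)` is the derivative along the curve of
`DF(V)`, which equals `(0, 2s)`. No second derivatives of `u² / v` are computed. -/
lemma quadratic_gmField {c β d b : ℝ} (hβ : 0 < β) (hd : 0 < d) :
    iteratedFDeriv ℝ 2 (gmField c β d b) (gmE1 β d) ![(1, β), (1, β)] = (0, 2) := by
  have hE := gmPositive_gmE1 hβ hd
  have hsm : ContDiffAt ℝ ∞ (gmField c β d b) (gmE1 β d) :=
    (contDiffAt_gmField c β d b hE.2.ne').comp (gmE1 β d) (contDiffAt_const.prodMk contDiffAt_id)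
  have hdiff : DifferentiableAt ℝ (fderiv ℝ (gmField c β d b)) (gmE1 β d) :=
    (hsm.fderiv_right (m := 1) (by norm_cast)).differentiableAt (by norm_num)
  rw [iteratedFDeriv_two_apply]
  simp only [Matrix.cons_val_zero, Matrix.cons_val_one]
  have h1 : HasDerivAt (fun s => fderiv ℝ (gmField c β d b) (gmCurve β d s) (1, β))
      (fderiv ℝ (fderiv ℝ (gmField c β d b)) (gmE1 β d) (1, β) (1, β)) 0 := by
    have h2 := (gmCurve_zero β d ▸ hdiff.hasFDerivAt :
      HasFDerivAt (fderiv ℝ (gmField c β d b)) (fderiv ℝ (fderiv ℝ (gmField c β d b)) (gmE1 β d))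
        (gmCurve β d 0)).comp_hasDerivAt 0 (hasDerivAt_gmCurve β d 0)
    simpa using h2.clm_apply (hasDerivAt_const (0 : ℝ) ((1, β) : ℝ × ℝ))
  have hev : (fun s => fderiv ℝ (gmField c β d b) (gmCurve β d s) (1, β)) =ᶠ[𝓝 0]
      fun s => ((0 : ℝ), 2 * s) := by
    have hmem := (contDiff_gmCurve β d).continuous.continuousAt.eventually_mem
      (x := 0) (by rw [gmCurve_zero]; exact positiveQuadrant_mem_nhds hE)
    filter_upwards [hmem] with s hs
    rw [fderiv_gmField_gmCurve hβ hs]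
    ext
    · field_simp
      simp
    · simp
      ring
  have h3 : HasDerivAt (fun s : ℝ => ((0 : ℝ), 2 * s)) (0, 2) 0 := by
    simpa using (hasDerivAt_const (0 : ℝ) (0 : ℝ)).prodMk ((hasDerivAt_id (0 : ℝ)).const_mul 2)
  exact h1.unique (h3.congr_of_eventuallyEq hev)

/-! ### Transversality, fold and saddle-node at `E₁`. -/

lemma gmField_gmE1 {c β d : ℝ} (hc : 0 < c) (hβ : 0 < β) (hd : 0 < d) :
    gmField c β d (gmThreshold β d) (gmE1 β d) = 0 := by
  have h := gmField_gmCurve (s := 0) (d := d) hc hβ (by rw [abs_zero]; positivity)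
  rwa [gmCurve_zero, zero_pow two_ne_zero, sub_zero] at h

lemma fderiv_gmField_gmE1 {c β d b : ℝ} (hβ : 0 < β) (hd : 0 < d) (q : ℝ × ℝ) :
    fderiv ℝ (gmField c β d b) (gmE1 β d) q =
      (c * q.1 - c / β * q.2, d * β * q.1 - d * q.2) := by
  have hE := gmPositive_gmE1 hβ hd
  rw [← gmCurve_zero] at hE ⊢
  rw [fderiv_gmField_gmCurve hβ hE, add_zero, mul_div_cancel₀ _ two_ne_zero]

lemma gmField_transversality {c β d : ℝ} (hc : 0 < c) (hβ : 0 < β) (hd : 0 < d) :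
    TransversalityConditions (gmField c β d) (gmE1 β d) (gmThreshold β d) (1, β)
      (ContinuousLinearMap.fst ℝ ℝ ℝ - (c / (d * β)) • ContinuousLinearMap.snd ℝ ℝ ℝ) where
  smooth := contDiffAt_gmField c β d _ (gmPositive_gmE1 hβ hd).2.ne'
  equilibrium := gmField_gmE1 hc hβ hd
  finrank_ker := by
    have hker : LinearMap.ker (fderiv ℝ (gmField c β d (gmThreshold β d)) (gmE1 β d) :
        ℝ × ℝ →ₗ[ℝ] ℝ × ℝ) = Submodule.span ℝ {((1, β) : ℝ × ℝ)} := by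
      ext q
      rw [LinearMap.mem_ker, ContinuousLinearMap.coe_coe, fderiv_gmField_gmE1 hβ hd,
        Submodule.mem_span_singleton]
      constructor
      · intro h
        refine ⟨q.1, Prod.ext (by simp) ?_⟩
        -- The rows are proportional, so the second one alone determines the kernel.
        have h2 : d * β * q.1 - d * q.2 = 0 := congrArg Prod.snd h
        have : d * (q.1 * β) = d * q.2 := by linarith
        simpa using mul_left_cancel₀ hd.ne' this
      · rintro ⟨a, rfl⟩
        ext
        · simp
          field_simp
          simp
        · simp
          ring
    rw [hker, finrank_span_singleton (by simp)]
  right_ne := by simp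
  right_null := by
    rw [fderiv_gmField_gmE1 hβ hd]
    ext
    · simp
      field_simp
      simp
    · simp
  left_ne := fun h => by simpa using DFunLike.congr_fun h ((1, 0) : ℝ × ℝ)
  left_null := by
    refine ContinuousLinearMap.ext fun q => ?_
    rw [ContinuousLinearMap.comp_apply, fderiv_gmField_gmE1 hβ hd]
    simp
    field_simp
    ring
  param := by
    have h : HasDerivAt (fun b => gmField c β d b (gmE1 β d)) (0, 1) (gmThreshold β d) := by
      have h1 := ((hasDerivAt_id (gmThreshold β d)).add_const ((gmE1 β d).1 ^ 2)).sub_const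
        (d * (gmE1 β d).2)
      exact (hasDerivAt_const _ _).prodMk h1
    rw [h.deriv]
    simp [hc.ne', hβ.ne', hd.ne']
  quadratic := by
    rw [quadratic_gmField hβ hd]
    simp [hc.ne', hβ.ne', hd.ne']

lemma gmField_isFold {c β d : ℝ} (hc : 0 < c) (hβ : 0 < β) (hd : 0 < d) :
    IsFold (gmField c β d) (gmE1 β d) (gmThreshold β d) (-1) where
  smooth := contDiffAt_gmField c β d _ (gmPositive_gmE1 hβ hd).2.ne'
  curve := by
    have hδ : 0 < d * β / 2 := by positivity
    have hm : ∀ s : ℝ, HasDerivAt (fun s => gmThreshold β d - s ^ 2) (-(2 * s)) s := fun s => by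
      simpa using (hasDerivAt_pow 2 s).const_sub (gmThreshold β d)
    have hm1 : deriv (fun s => gmThreshold β d - s ^ 2) = fun s => -(2 * s) :=
      funext fun s => (hm s).deriv
    have hm2 : iteratedDeriv 2 (fun s => gmThreshold β d - s ^ 2) 0 = -2 := by
      rw [iteratedDeriv_succ, iteratedDeriv_one, hm1]
      simp
    -- With `δ = dβ/2`, the bound `s > -δ` is `u > 0`, and `s < δ` is `u < dβ`.
    refine ⟨d * β / 2, gmCurve β d, fun s => gmThreshold β d - s ^ 2, hδ,
      (contDiff_gmCurve β d).contDiffOn, by fun_prop, gmCurve_zero β d, by simp, ?_, ?_, ?_, ?_⟩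
    · rw [(hasDerivAt_gmCurve β d 0).deriv]
      simp
    · simp
    · rw [hm2]
      norm_num
    · have hpos : ∀ᶠ p : ℝ × (ℝ × ℝ) in 𝓝 (gmThreshold β d, gmE1 β d), 0 < p.2.1 ∧ 0 < p.2.2 :=
        continuousAt_snd.eventually_mem (positiveQuadrant_mem_nhds (gmPositive_gmE1 hβ hd))
      have hlt : ∀ᶠ p : ℝ × (ℝ × ℝ) in 𝓝 (gmThreshold β d, gmE1 β d), p.2.1 < d * β :=
        (continuous_snd.fst.continuousAt).eventually_lt continuousAt_const
          (by simp only [gmE1]; linarith)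
      filter_upwards [hpos, hlt] with p ⟨h1, h2⟩ h3
      constructor
      · intro h
        obtain ⟨h4, h5⟩ := (gmField_eq_zero_iff hc h1 h2).1 h
        exact ⟨p.2.1 - d * β / 2, ⟨by linarith, by linarith⟩, Prod.ext h5 h4⟩
      · rintro ⟨s, hs, rfl⟩
        exact gmField_gmCurve hc hβ (abs_lt.2 hs)
  count := by
    refine ⟨_, positiveQuadrant_mem_nhds (gmPositive_gmE1 hβ hd), fun N hN hNU => ?_⟩
    filter_upwards [eventually_gmCurve_mem β d hN] with b ⟨hm, hp⟩
    simp only [Units.val_neg, Units.val_one, Int.cast_neg, Int.cast_one]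
    refine ⟨fun hb => ?_, ?_, fun hb => ?_⟩
    · have hb' : b < gmThreshold β d := by linarith
      have hs : 0 < √(gmThreshold β d - b) := Real.sqrt_pos.2 (by linarith)
      -- The determinant has the sign of `s`, so the point with `s = -√(b_SN - b)` comes first.
      refine ⟨_, _, gmCurve_neg_sqrt_ne hb', equilibria_eq_pair hc hNU hb'.le hm hp, ?_, ?_⟩
      · rw [det_fderiv_gmField_gmCurve hβ (hNU hm)]
        exact mul_neg_of_pos_of_neg (by positivity) (by linarith)
      · rw [det_fderiv_gmField_gmCurve hβ (hNU hp)]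
        positivity
    · rintro rfl
      rw [equilibria_eq_pair hc hNU le_rfl hm hp]
      simp [gmCurve_zero]
    · have hemp := gmPositiveEquilibria_eq_of_lt hc (show gmThreshold β d < b by linarith)
      refine Set.eq_empty_iff_forall_notMem.2 fun w ⟨hw, h⟩ => ?_
      exact Set.eq_empty_iff_forall_notMem.1 hemp w ⟨(hNU hw).1, (hNU hw).2, h⟩

lemma gmField_isSaddleNodeBifurcation {c β d : ℝ} (hc : 0 < c) (hβ : 0 < β) (hd : 0 < d)
    (hdc : d ≠ c) :
    IsSaddleNodeBifurcation (gmField c β d) (gmE1 β d) (gmThreshold β d) (-1) := by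
  have hE : 0 < (gmCurve β d 0).1 ∧ 0 < (gmCurve β d 0).2 := by
    rw [gmCurve_zero]
    exact gmPositive_gmE1 hβ hd
  have hdet : (fderiv ℝ (gmField c β d (gmThreshold β d)) (gmE1 β d)).det = 0 := by
    rw [← gmCurve_zero, det_fderiv_gmField_gmCurve hβ hE, mul_zero]
  have htr := trace_fderiv_gmField_gmCurve (c := c) (b := gmThreshold β d) hβ hE
  rw [gmCurve_zero] at htr
  have heig := complexEigenvalues_of_det_eq_zero hdet
  rw [htr] at heig
  have hcd : c - d ≠ 0 := sub_ne_zero.2 hdc.symm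
  have hdim := stableDim_eq_of_complexEigenvalues heig
  refine ⟨gmField_isFold hc hβ hd, rootMultiplicity_zero_charpoly_of_det_eq_zero hdet
    (by rwa [htr]), ?_, ?_⟩
  · rw [heig]
    intro z hz hz0
    simp only [Multiset.insert_eq_cons, Multiset.mem_cons, Multiset.mem_singleton, hz0,
      false_or] at hz
    rwa [hz, Complex.ofReal_re]
  · refine ⟨_, positiveQuadrant_mem_nhds (gmPositive_gmE1 hβ hd), fun N hN hNU => ?_⟩
    filter_upwards [eventually_gmCurve_mem β d hN] with b ⟨hm, hp⟩ hb
    simp only [Units.val_neg, Units.val_one, Int.cast_neg, Int.cast_one] at hb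
    have hb' : b < gmThreshold β d := by linarith
    have hs : 0 < √(gmThreshold β d - b) := Real.sqrt_pos.2 (by linarith)
    have hpair := equilibria_eq_pair hc hNU hb'.le hm hp
    have hm0 : gmField c β d b (gmCurve β d (-√(gmThreshold β d - b))) = 0 :=
      ((Set.ext_iff.1 hpair _).2 (Or.inl rfl)).2
    have hp0 : gmField c β d b (gmCurve β d (√(gmThreshold β d - b))) = 0 :=
      ((Set.ext_iff.1 hpair _).2 (Or.inr rfl)).2
    have hmd := (hasFDerivAt_gmField c β d b (hNU hm).2.ne').differentiableAt
    have hpd := (hasFDerivAt_gmField c β d b (hNU hp).2.ne').differentiableAt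
    obtain ⟨hsh, hsd⟩ : _ ∧ stableDim (fderiv ℝ (gmField c β d b)
        (gmCurve β d (-√(gmThreshold β d - b)))) = 1 := saddle_of_det_neg (by
      rw [det_fderiv_gmField_gmCurve hβ (hNU hm)]
      exact mul_neg_of_pos_of_neg (by positivity) (by linarith))
    have hdp : 0 < (fderiv ℝ (gmField c β d b) (gmCurve β d (√(gmThreshold β d - b)))).det := by
      rw [det_fderiv_gmField_gmCurve hβ (hNU hp)]
      positivity
    have htp := trace_fderiv_gmField_gmCurve (c := c) (b := b) hβ (hNU hp)
    -- If `c < d`, then `k = 1`: the saddle has stable dimension `k` and the sink `k + 1`. If `c >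
    -- d`, then `k = 0`: the source has `k` and the saddle `k + 1`, so the two points swap roles.
    rcases hcd.lt_or_gt with hneg | hpos
    · obtain ⟨hnh, hnd⟩ := sink_of_det_pos hdp (by rwa [htp])
      refine ⟨_, _, gmCurve_neg_sqrt_ne hb', hpair, ⟨hm0, hmd, hsh⟩, ⟨hp0, hpd, hnh⟩, ?_, ?_⟩
      · rw [hsd, hdim]
        simp [-Complex.ofReal_sub, hneg]
      · rw [hnd, hdim]
        simp [-Complex.ofReal_sub, hneg]
    · obtain ⟨hnh, hnd⟩ := source_of_det_pos hdp (by rwa [htp])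
      refine ⟨_, _, (gmCurve_neg_sqrt_ne hb').symm, hpair.trans (Set.pair_comm _ _),
        ⟨hp0, hpd, hnh⟩, ⟨hm0, hmd, hsh⟩, ?_, ?_⟩
      · rw [hnd, hdim]
        simp [-Complex.ofReal_sub, (sub_pos.1 hpos).le]
      · rw [hsd, hdim]
        simp [-Complex.ofReal_sub, (sub_pos.1 hpos).le]

theorem theorem4 (c β d : ℝ) (hc : 0 < c) (hβ : 0 < β) (hd : 0 < d) :
    -- the numbers of positive equilibria
    (∀ b : ℝ, gmThreshold β d < b → gmPositiveEquilibria c β d b = ∅) ∧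
    gmPositiveEquilibria c β d (gmThreshold β d) = {gmE1 β d} ∧
    (∀ b : ℝ, 0 < b → b < gmThreshold β d → (gmPositiveEquilibria c β d b).encard = 2) ∧
    -- the transversality conditions, with V = (1, β) and W = (1, -c / (d β))
    TransversalityConditions (gmField c β d) (gmE1 β d) (gmThreshold β d) (1, β)
      (ContinuousLinearMap.fst ℝ ℝ ℝ - (c / (d * β)) • ContinuousLinearMap.snd ℝ ℝ ℝ) ∧
    -- two equilibria, with Jacobian determinants of opposite sign, merge at E₁ and disappear
    -- as b increases through the threshold
    IsFold (gmField c β d) (gmE1 β d) (gmThreshold β d) (-1) ∧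
    -- and this is a saddle-node bifurcation whenever 0 is a simple eigenvalue, i.e. for d ≠ c
    (d ≠ c → IsSaddleNodeBifurcation (gmField c β d) (gmE1 β d) (gmThreshold β d) (-1)) := by
  refine ⟨fun b hb => gmPositiveEquilibria_eq_of_lt hc hb, ?_, fun b h0 hb => ?_,
    gmField_transversality hc hβ hd, gmField_isFold hc hβ hd,
    gmField_isSaddleNodeBifurcation hc hβ hd⟩
  · rw [gmPositiveEquilibria_eq_pair hc hβ hd (gmThreshold_pos hβ hd) le_rfl]
    simp [gmCurve_zero]
  · rw [gmPositiveEquilibria_eq_pair hc hβ hd h0 hb.le, Set.encard_pair (gmCurve_neg_sqrt_ne hb)]
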